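/- Let $d,M,n\in\mathbb{N}=\{1,2,\dots\}$, $m\in\mathbb{N}\cup\{0\}$ and $N=(2M+1)^d$. Let $\mathbb{T}^d=(\mathbb{R}/\mathbb{Z})^d$ carry its normalised Lebesgue (probability) measure, let $C(\mathbb{T}^d)$ be the space of continuous complex-valued functions on $\mathbb{T}^d$, and let $\mathcal{T}(Q_M)=\operatorname{span}_{\mathbb{C}}\{e^{2\pi i k\cdot x}: k\in Q_M\}$ with $Q_M=[-M,M]^d\cap\mathbb{Z}^d$. For $f\in C(\mathbb{T}^d)$ and $s\in\mathbb{N}$ put $$\sigma_{s}(f)_{L_\infty}=\inf_{S\subset\mathbb{Z}^d,\ |S|\le s}\ \inf_{(c_k)\in\mathbb{C}^S}\Big\|f-\sum_{k\in S}c_k e^{2\pi i k\cdot x}\Big\|_{L_\infty(\mathbb{T}^d)},\qquad E_{Q_M}(f)_Y=\inf_{g\in\mathcal{T}(Q_M)}\|f-g\|_Y ,$$ where $\|\cdot\|_Y$ is an arbitrary norm (or seminorm) on $C(\mathbb{T}^d)$, for instance the $L_\infty$ norm. A sampling recovery map is a map $T_{\mathbf X}:C(\mathbb{T}^d)\to L_2(\mathbb{T}^d)$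 of the form $T_{\mathbf X}(f)=T(f(x^1),\dots,f(x^m))$ with points $\mathbf X=(x^1,\dots,x^m)$ in $\mathbb{T}^d$ and an arbitrary, possibly nonlinear, map $T:\mathbb{C}^m\to L_2(\mathbb{T}^d)$. For $C>0$ consider the condition $$\|f-T_{\mathbf X}(f)\|_{L_2}\le C\big(\sigma_{2n}(f)_{L_\infty}+E_{Q_M}(f)_Y\big)\qquad\text{for all } f\in C(\mathbb{T}^d).\tag{$*$}$$ **Theorem.** (i) There is an absolute constant $c\ge 1$ such that for all $C>0$ and all $d,M,n,m,Y,\mathbf X,T$ as above, condition $(*)$ implies $$m\ \ge\ n\,\frac{\log\big(N/(4n)\big)}{4\log\big(C'd\log N\big)},\qquad C'=c\,(1+C).$$ (ii) Consequently $m=\mathcal{O}(n)$ samples do not suffice: for all $C,K>0$ and every $n\in\mathbb{N}$ there is $N_0$ such that for all $d,M$ with $(2M+1)^d\ge N_0$, every sampling recovery map satisfying $(*)$ (for any $m,Y,\mathbf X,T$) uses $m>Kn$ samples. -/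

import Mathlib

open MeasureTheory

/-- The normalised Haar (Lebesgue) probability measure on the `d`-torus `(ℝ / ℤ)^d`. -/
noncomputable abbrev torusMeasure (d : ℕ) : Measure (UnitAddTorus (Fin d)) :=
  Measure.pi (fun _ : Fin d => AddCircle.haarAddCircle)

/-- The Hilbert space `L₂(𝕋^d)` of complex-valued functions. -/
noncomputable abbrev TorusL2 (d : ℕ) : Type :=
  Lp ℂ 2 (torusMeasure d)

/-- A continuous function on the torus, viewed as an element of `L₂(𝕋^d)`. -/
noncomputable def toTorusL2 {d : ℕ} (f : C(UnitAddTorus (Fin d), ℂ)) : TorusL2 d :=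
  ContinuousMap.toLp 2 (torusMeasure d) ℂ f

/-- The discrete cube `Q_M = [-M, M]^d ∩ ℤ^d`. -/
def freqCube (d M : ℕ) : Set (Fin d → ℤ) :=
  {k | ∀ i, |k i| ≤ (M : ℤ)}

/-- The trigonometric polynomials `𝒯(Q_M)`: the complex span of the functions
`x ↦ exp (2πi k·x)` with `k ∈ Q_M`. -/
noncomputable def trigPoly (d M : ℕ) : Submodule ℂ C(UnitAddTorus (Fin d), ℂ) :=
  Submodule.span ℂ (UnitAddTorus.mFourier '' freqCube d M)

/-- `σ_s(f; 𝒯^d)` in `L_∞`: the error of best `s`-term approximation of the continuous function `f`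
by the multivariate trigonometric system, with all of `ℤ^d` as admissible frequencies. On continuous
functions the `L_∞` norm is the supremum norm, which is the norm of `C(𝕋^d, ℂ)`. -/
noncomputable def bestTermError {d : ℕ} (s : ℕ) (f : C(UnitAddTorus (Fin d), ℂ)) : ℝ :=
  sInf {r : ℝ | ∃ (S : Finset (Fin d → ℤ)) (c : (Fin d → ℤ) → ℂ),
    S.card ≤ s ∧ r = ‖f - ∑ k ∈ S, c k • UnitAddTorus.mFourier k‖}

/-- `E_{Q_M}(f)_Y`: the error of best approximation of `f` from `𝒯(Q_M)`, measured in the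
(semi)norm `Y`. -/
noncomputable def cubeError {d : ℕ} (M : ℕ) (Y : Seminorm ℂ C(UnitAddTorus (Fin d), ℂ))
    (f : C(UnitAddTorus (Fin d), ℂ)) : ℝ :=
  sInf {r : ℝ | ∃ g ∈ trigPoly d M, r = Y (f - g)}

/-- The recovery map `T_X (f) = T (f (x¹), …, f (x^m))` built from the sampling points `X` and the
(arbitrary, possibly nonlinear) reconstruction `T : ℂ^m → L₂(𝕋^d)`. -/
noncomputable def recoveryMap {d m : ℕ} (X : Fin m → UnitAddTorus (Fin d)) (T : (Fin m → ℂ) → TorusL2 d)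
    (f : C(UnitAddTorus (Fin d), ℂ)) : TorusL2 d :=
  T (fun l => f (X l))

/-- The error bound `‖f - R f‖_{L₂} ≤ C (σ_{2n}(f; 𝒯^d)_{L_∞} + E_{Q_M}(f)_Y)` for all
continuous `f`, for a map `R : C(𝕋^d) → L₂(𝕋^d)`. -/
def SatisfiesErrorBound {d : ℕ} (C : ℝ) (n M : ℕ) (Y : Seminorm ℂ C(UnitAddTorus (Fin d), ℂ))
    (R : C(UnitAddTorus (Fin d), ℂ) → TorusL2 d) : Prop :=
  ∀ f : C(UnitAddTorus (Fin d), ℂ),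
    ‖toTorusL2 f - R f‖ ≤ C * (bestTermError (2 * n) f + cubeError M Y f)

/-! The proof packs many sparse polynomials into a space of real dimension at most `2 * m`. A
Gilbert–Varshamov argument (`exists_family_large_sdiff`) yields at least `(N/(4n))^(n/2)` sets of
`n` frequencies in the cube, any two differing substantially. Each set `S` carries a polynomial
`f_S` with unimodular coefficients and uniform norm at most `8q√n`, where `q = ⌈log N⌉`
(`exists_sign_norm_le`).

A difference `v = f_S - f_S'` is `2n`-sparse and lies in `𝒯(Q_M)`, so the error bound forces exact
recovery of `v`. If `z ∈ 𝒯(Q_M)` has the same samples, it has the same reconstruction `v`, whence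
`‖v‖₂ ≤ (1 + C)‖z‖_∞`. Bessel's inequality gives `‖v‖₂ ≥ √n/2`. Hence the `f_S` stay `√n/(2(1 +
C))`-separated modulo the kernel of the sampling map. The quotient has complex dimension at most
`m`, so comparing volumes bounds the number of sets by `(1 + 32(1 + C)q)^(2m)`. Taking logarithms
gives (i). No regularity of `T` enters: only its being a function of the samples matters. -/

/-! ### Trigonometric polynomials in `L₂` and in the uniform norm -/

theorem orthonormal_toTorusL2_mFourier (d : ℕ) :
    Orthonormal ℂ (fun k : Fin d → ℤ => toTorusL2 (UnitAddTorus.mFourier k)) :=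
  UnitAddTorus.orthonormal_mFourier

theorem toTorusL2_sub {d : ℕ} (f g : C(UnitAddTorus (Fin d), ℂ)) :
    toTorusL2 (f - g) = toTorusL2 f - toTorusL2 g :=
  map_sub (ContinuousMap.toLp 2 (torusMeasure d) ℂ) f g

theorem toTorusL2_sum_smul {d : ℕ} {ι : Type*} (s : Finset ι) (c : ι → ℂ)
    (f : ι → C(UnitAddTorus (Fin d), ℂ)) :
    toTorusL2 (∑ i ∈ s, c i • f i) = ∑ i ∈ s, c i • toTorusL2 (f i) := by
  simp only [toTorusL2, map_sum, map_smul]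

theorem norm_toTorusL2_le {d : ℕ} (f : C(UnitAddTorus (Fin d), ℂ)) : ‖toTorusL2 f‖ ≤ ‖f‖ := by
  refine ((ContinuousMap.toLp 2 (torusMeasure d) ℂ).le_opNorm f).trans ?_
  refine mul_le_of_le_one_left (norm_nonneg _) ?_
  refine (ContinuousMap.toLp_norm_le (p := 2) (μ := torusMeasure d) (𝕜 := ℂ) (E := ℂ)).trans ?_
  simp [measureUnivNNReal]

theorem norm_toTorusL2_sq {d : ℕ} (f : C(UnitAddTorus (Fin d), ℂ)) :
    ‖toTorusL2 f‖ ^ 2 = ∫ x, ‖f x‖ ^ 2 ∂torusMeasure d := by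
  have h := ContinuousMap.inner_toLp (𝕜 := ℂ) (μ := torusMeasure d) f f
  have h2 : ∀ x, f x * (starRingEnd ℂ) (f x) = ((‖f x‖ ^ 2 : ℝ) : ℂ) := fun x => by
    rw [Complex.mul_conj, Complex.normSq_eq_norm_sq]
  simp only [h2] at h
  rw [integral_complex_ofReal] at h
  rw [← inner_self_eq_norm_sq (𝕜 := ℂ), toTorusL2, h]
  exact Complex.ofReal_re _

/-- Nikolskii's inequality between the uniform and the quadratic norm. -/
theorem norm_sq_le_card_mul_norm_toTorusL2_sq {d : ℕ} (Λ : Finset (Fin d → ℤ))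
    (f : C(UnitAddTorus (Fin d), ℂ))
    (hf : f ∈ Submodule.span ℂ (UnitAddTorus.mFourier '' (Λ : Set (Fin d → ℤ)))) :
    ‖f‖ ^ 2 ≤ Λ.card * ‖toTorusL2 f‖ ^ 2 := by
  classical
  obtain ⟨c, rfl⟩ : ∃ c : (Fin d → ℤ) → ℂ, ∑ k ∈ Λ, c k • UnitAddTorus.mFourier k = f := by
    rw [Submodule.mem_span_image_finset_iff_exists_fun] at hf
    obtain ⟨c, hc⟩ := hf
    refine ⟨fun k => if h : k ∈ Λ then c ⟨k, h⟩ else 0, ?_⟩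
    rw [← hc, ← Finset.sum_coe_sort Λ]
    simp
  have h2 : ‖toTorusL2 (∑ k ∈ Λ, c k • UnitAddTorus.mFourier k)‖ ^ 2 = ∑ k ∈ Λ, ‖c k‖ ^ 2 := by
    rw [toTorusL2_sum_smul]
    rw [← inner_self_eq_norm_sq (𝕜 := ℂ), (orthonormal_toTorusL2_mFourier d).inner_sum, map_sum]
    refine Finset.sum_congr rfl fun k _ => ?_
    rw [mul_comm, Complex.mul_conj, Complex.normSq_eq_norm_sq]
    exact Complex.ofReal_re _
  have h1 : ‖∑ k ∈ Λ, c k • UnitAddTorus.mFourier k‖ ≤ ∑ k ∈ Λ, ‖c k‖ := by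
    refine (norm_sum_le _ _).trans (le_of_eq (Finset.sum_congr rfl fun k _ => ?_))
    rw [norm_smul, UnitAddTorus.mFourier_norm, mul_one]
  rw [h2]
  calc _ ≤ (∑ k ∈ Λ, ‖c k‖) ^ 2 := by gcongr
    _ ≤ _ := sq_sum_le_card_mul_sum_sq

/-- The discrete cube as a finite set. -/
noncomputable def freqCubeFinset (d M : ℕ) : Finset (Fin d → ℤ) :=
  Fintype.piFinset fun _ => Finset.Icc (-(M : ℤ)) M

theorem coe_freqCubeFinset (d M : ℕ) : (freqCubeFinset d M : Set (Fin d → ℤ)) = freqCube d M := by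
  ext k
  simp [freqCubeFinset, freqCube, abs_le, Pi.le_def, forall_and]

theorem card_freqCubeFinset (d M : ℕ) : (freqCubeFinset d M).card = (2 * M + 1) ^ d := by
  simp only [freqCubeFinset, Fintype.card_piFinset, Int.card_Icc, Finset.prod_const,
    Finset.card_univ, Fintype.card_fin]
  congr 1
  omega

theorem mFourier_mem_trigPoly {d M : ℕ} {k : Fin d → ℤ} (hk : k ∈ freqCubeFinset d M) :
    UnitAddTorus.mFourier k ∈ trigPoly d M :=
  Submodule.subset_span ⟨k, by rwa [← coe_freqCubeFinset], rfl⟩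

instance finiteDimensional_trigPoly (d M : ℕ) : FiniteDimensional ℂ (trigPoly d M) := by
  rw [trigPoly, ← coe_freqCubeFinset]
  exact FiniteDimensional.span_of_finite ℂ ((Finset.finite_toSet _).image _)

theorem mul_mem_trigPoly {d M M' : ℕ} {f g : C(UnitAddTorus (Fin d), ℂ)}
    (hf : f ∈ trigPoly d M) (hg : g ∈ trigPoly d M') : f * g ∈ trigPoly d (M + M') := by
  have h := Submodule.mul_mem_mul hf hg
  rw [trigPoly, trigPoly, Submodule.span_mul_span] at h
  refine Submodule.span_mono ?_ h
  rintro _ ⟨_, ⟨k, hk, rfl⟩, _, ⟨l, hl, rfl⟩, rfl⟩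
  refine ⟨k + l, fun i => ?_, ?_⟩
  · have h1 := hk i
    have h2 := hl i
    have h3 := abs_add_le (k i) (l i)
    push_cast
    simp only [Pi.add_apply]
    linarith
  · ext x
    exact UnitAddTorus.mFourier_add

theorem pow_mem_trigPoly {d M : ℕ} {f : C(UnitAddTorus (Fin d), ℂ)}
    (hf : f ∈ trigPoly d M) (q : ℕ) : f ^ q ∈ trigPoly d (q * M) := by
  induction q with
  | zero =>
    rw [pow_zero, ← UnitAddTorus.mFourier_zero]
    exact Submodule.subset_span ⟨0, fun i => by simp, rfl⟩
  | succ q ih =>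
    rw [pow_succ, Nat.succ_mul]
    exact mul_mem_trigPoly ih hf

/-! ### Packing and codes -/

/-- Volumetric bound on the size of a separated subset of a ball. -/
theorem card_le_of_separated_of_norm_le {E : Type*} [NormedAddCommGroup E] [NormedSpace ℝ E]
    [FiniteDimensional ℝ E] (s : Finset E) {R δ : ℝ} (hR : 0 ≤ R) (hδ : 0 < δ)
    (hs : ∀ c ∈ s, ‖c‖ ≤ R) (h : ∀ c ∈ s, ∀ d ∈ s, c ≠ d → δ ≤ ‖c - d‖) :
    (s.card : ℝ) ≤ (1 + 2 * R / δ) ^ Module.finrank ℝ E := by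
  borelize E
  let μ : Measure E := Measure.addHaar
  have hδ2 : 0 < δ / 2 := by positivity
  have ρpos : 0 < δ / 2 + R := by positivity
  have D : Set.Pairwise (s : Set E) (Function.onFun Disjoint fun c => Metric.ball c (δ / 2)) := by
    rintro c hc d hd hcd
    apply Metric.ball_disjoint_ball
    rw [dist_eq_norm]
    have := h c hc d hd hcd
    linarith
  have A_subset : (⋃ c ∈ s, Metric.ball c (δ / 2)) ⊆ Metric.ball (0 : E) (δ / 2 + R) := by
    refine Set.iUnion₂_subset fun x hx => Metric.ball_subset_ball' ?_
    rw [dist_zero_right]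
    have := hs x hx
    linarith
  have I : (s.card : ENNReal) * ENNReal.ofReal ((δ / 2) ^ Module.finrank ℝ E) *
      μ (Metric.ball 0 1) ≤
      ENNReal.ofReal ((δ / 2 + R) ^ Module.finrank ℝ E) * μ (Metric.ball 0 1) :=
    calc
      _ = μ (⋃ c ∈ s, Metric.ball c (δ / 2)) := by
        rw [measure_biUnion_finset D fun c _ => measurableSet_ball]
        simp only [μ.addHaar_ball_of_pos _ hδ2, Finset.sum_const, nsmul_eq_mul, mul_assoc]
      _ ≤ μ (Metric.ball (0 : E) (δ / 2 + R)) := measure_mono A_subset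
      _ = _ := by simp only [μ.addHaar_ball_of_pos _ ρpos]
  have J : (s.card : ENNReal) * ENNReal.ofReal ((δ / 2) ^ Module.finrank ℝ E) ≤
      ENNReal.ofReal ((δ / 2 + R) ^ Module.finrank ℝ E) :=
    (ENNReal.mul_le_mul_iff_left (Metric.measure_ball_pos _ _ zero_lt_one).ne'
      measure_ball_lt_top.ne).1 I
  have K := ENNReal.toReal_le_of_le_ofReal (pow_nonneg ρpos.le _) J
  rw [ENNReal.toReal_mul, ENNReal.toReal_natCast, ENNReal.toReal_ofReal (by positivity)] at K
  have e : 1 + 2 * R / δ = (δ / 2 + R) / (δ / 2) := by field_simp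
  rw [e, div_pow, le_div_iff₀ (by positivity)]
  exact K

/-- A word near `w` is determined by its set of disagreement (at most `2 ^ n` choices) and its
letters there (at most `B ^ (n / 4)` choices). -/
theorem card_hamming_ball_le {n B : ℕ} (w : Fin n → Fin B) :
    (Finset.univ.filter fun u : Fin n → Fin B =>
      4 * (Finset.univ.filter fun i => u i ≠ w i).card < n).card ≤ 2 ^ n * B ^ (n / 4) := by
  rcases Nat.eq_zero_or_pos B with rfl | hB
  · rcases Nat.eq_zero_or_pos n with rfl | hn
    · simp
    · exact (w ⟨0, hn⟩).elim0
  have hsub : (Finset.univ.filter fun u : Fin n → Fin B =>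
      4 * (Finset.univ.filter fun i => u i ≠ w i).card < n) ⊆
      ((Finset.univ : Finset (Finset (Fin n))).filter fun A => 4 * A.card < n).biUnion fun A =>
        Fintype.piFinset fun i => if i ∈ A then Finset.univ else {w i} := by
    intro u hu
    simp only [Finset.mem_filter, Finset.mem_univ, true_and] at hu
    simp only [Finset.mem_biUnion, Finset.mem_filter, Finset.mem_univ, true_and]
    refine ⟨_, hu, Fintype.mem_piFinset.2 fun i => ?_⟩
    by_cases h : u i = w i <;> simp [h]
  refine (Finset.card_le_card hsub).trans ?_
  refine (Finset.card_biUnion_le_card_mul _ _ (B ^ (n / 4)) fun A hA => ?_).trans ?_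
  · simp only [Finset.mem_filter, Finset.mem_univ, true_and] at hA
    rw [Fintype.card_piFinset]
    have : ∀ i, (if i ∈ A then (Finset.univ : Finset (Fin B)) else {w i}).card =
        if i ∈ A then B else 1 := fun i => by split_ifs <;> simp
    simp only [this]
    rw [Finset.prod_ite_mem, Finset.univ_inter, Finset.prod_const]
    exact Nat.pow_le_pow_right hB (by omega)
  · gcongr
    refine (Finset.card_filter_le _ _).trans ?_
    simp

/-- Gilbert–Varshamov bound. -/
theorem exists_code {n B : ℕ} (hB : 4 ≤ B) :
    ∃ 𝒞 : Finset (Fin n → Fin B),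
      (∀ u ∈ 𝒞, ∀ w ∈ 𝒞, u ≠ w → n ≤ 4 * (Finset.univ.filter fun i => u i ≠ w i).card) ∧
      (B + 1) ^ n ≤ 4 ^ n * 𝒞.card ^ 2 := by
  classical
  let P : Finset (Fin n → Fin B) → Prop := fun 𝒞 =>
    ∀ u ∈ 𝒞, ∀ w ∈ 𝒞, u ≠ w → n ≤ 4 * (Finset.univ.filter fun i => u i ≠ w i).card
  obtain ⟨𝒞, h𝒞, hmax⟩ := (Finset.univ.filter P).exists_max_image Finset.card
    ⟨∅, by simp [P]⟩
  simp only [Finset.mem_filter, Finset.mem_univ, true_and] at h𝒞 hmax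
  refine ⟨𝒞, h𝒞, ?_⟩
  rcases Nat.eq_zero_or_pos n with rfl | hn
  · have := hmax {fun i => i.elim0} (by simp [P])
    rw [Finset.card_singleton] at this
    simpa using Nat.one_le_pow 2 _ this
  -- By maximality, a word outside all these Hamming balls could be added to the code.
  have hcover : (Finset.univ : Finset (Fin n → Fin B)) ⊆ 𝒞.biUnion fun w =>
      Finset.univ.filter fun u : Fin n → Fin B =>
        4 * (Finset.univ.filter fun i => u i ≠ w i).card < n := by
    intro u _
    simp only [Finset.mem_biUnion, Finset.mem_filter, Finset.mem_univ, true_and]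
    by_contra! hcon
    have hu : u ∉ 𝒞 := fun hu => by
      have := hcon u hu
      simp at this
      omega
    have hP : P (insert u 𝒞) := by
      intro a ha b hb hab
      rw [Finset.mem_insert] at ha hb
      rcases ha with rfl | ha <;> rcases hb with rfl | hb
      · exact absurd rfl hab
      · exact hcon b hb
      · simpa only [ne_comm] using hcon a ha
      · exact h𝒞 a ha b hb hab
    have := hmax _ hP
    rw [Finset.card_insert_of_notMem hu] at this
    omega
  have h1 : B ^ n ≤ 𝒞.card * (2 ^ n * B ^ (n / 4)) := by
    have := (Finset.card_le_card hcover).trans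
      (Finset.card_biUnion_le_card_mul _ _ _ fun w _ => card_hamming_ball_le w)
    simpa using this
  have h2 : (B ^ (n / 4)) ^ 4 ≤ B ^ n := by
    rw [← pow_mul]
    exact Nat.pow_le_pow_right (by omega) (by omega)
  -- Fourth powers clear the rounded exponent `n / 4`; afterwards `B ^ n` cancels and `(B + 1) ^ 2 ≤
  -- B ^ 3` finishes.
  have h3 : B ^ n * B ^ (3 * n) ≤ B ^ n * (4 ^ n * 𝒞.card ^ 2) ^ 2 :=
    calc B ^ n * B ^ (3 * n) = (B ^ n) ^ 4 := by ring
      _ ≤ (𝒞.card * (2 ^ n * B ^ (n / 4))) ^ 4 := by gcongr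
      _ = (𝒞.card * 2 ^ n) ^ 4 * (B ^ (n / 4)) ^ 4 := by ring
      _ ≤ (𝒞.card * 2 ^ n) ^ 4 * B ^ n := by gcongr
      _ = B ^ n * (4 ^ n * 𝒞.card ^ 2) ^ 2 := by
        rw [show (4 : ℕ) = 2 ^ 2 by norm_num, ← pow_mul, mul_comm 2 n]; ring
  have h4 := Nat.le_of_mul_le_mul_left h3 (by positivity)
  have h5 : ((B + 1) ^ n) ^ 2 ≤ B ^ (3 * n) := by
    rw [← pow_mul, mul_comm n 2, pow_mul, pow_mul B 3 n]
    exact Nat.pow_le_pow_left (by nlinarith) n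
  exact (Nat.pow_le_pow_iff_left two_ne_zero).1 (h5.trans h4)

/-- A large family of `n`-element subsets with pairwise large differences. -/
theorem exists_family_large_sdiff {α : Type*} [DecidableEq α] (Λ : Finset α) {n : ℕ} (hn : 1 ≤ n)
    (hΛ : 4 * n ≤ Λ.card) :
    ∃ 𝒮 : Finset (Finset α), (∀ S ∈ 𝒮, S ⊆ Λ ∧ S.card = n) ∧
      (∀ S ∈ 𝒮, ∀ S' ∈ 𝒮, S ≠ S' → n ≤ 4 * (S \ S').card) ∧
      Λ.card ^ n ≤ (4 * n) ^ n * 𝒮.card ^ 2 := by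
  classical
  set B := Λ.card / n with hBdef
  have hB : 4 ≤ B := (Nat.le_div_iff_mul_le (by omega)).2 hΛ
  obtain ⟨𝒞, h𝒞, hcard⟩ := exists_code (n := n) hB
  obtain ⟨φ⟩ : Nonempty ((Fin n × Fin B) ↪ Λ) := by
    apply Function.Embedding.nonempty_of_card_le
    simpa using Nat.mul_div_le Λ.card n
  -- `φ` places `n` disjoint blocks of size `B` in `Λ`. A word selects one point per block, so
  -- Hamming distance becomes size of set difference.
  let F : (Fin n → Fin B) → Finset α := fun w => Finset.univ.image fun i => (φ (i, w i) : α)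
  have hφ : ∀ {p p'}, (φ p : α) = φ p' → p = p' := fun h => φ.injective (Subtype.ext h)
  have hdiff : ∀ u w, (Finset.univ.filter fun i => u i ≠ w i).card ≤ (F u \ F w).card := by
    intro u w
    refine Finset.card_le_card_of_injOn (fun i => (φ (i, u i) : α)) (fun i hi => ?_)
      fun i _ j _ hij => congrArg Prod.fst (hφ hij)
    simp only [Finset.coe_filter, Finset.mem_univ, true_and, Set.mem_ofPred_eq] at hi
    simp only [F, Finset.coe_sdiff, Finset.coe_image, Finset.coe_univ, Set.image_univ,
      Set.mem_sdiff, Set.mem_range, exists_apply_eq_apply, true_and, not_exists]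
    intro j hj
    obtain ⟨rfl, h⟩ := Prod.mk.inj (hφ hj)
    exact hi h.symm
  have hsep : ∀ u ∈ 𝒞, ∀ w ∈ 𝒞, u ≠ w → n ≤ 4 * (F u \ F w).card := fun u hu w hw huw =>
    (h𝒞 u hu w hw huw).trans (Nat.mul_le_mul_left 4 (hdiff u w))
  have hinj : Set.InjOn F 𝒞 := by
    intro u hu w hw huw
    by_contra hne
    have := hsep u hu w hw hne
    rw [huw] at this
    simp at this
    omega
  refine ⟨𝒞.image F, ?_, ?_, ?_⟩
  · simp only [Finset.mem_image, forall_exists_index, and_imp, forall_apply_eq_imp_iff₂]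
    refine fun w _ => ⟨fun x hx => ?_, ?_⟩
    · obtain ⟨i, -, rfl⟩ := Finset.mem_image.1 hx
      exact (φ (i, w i)).2
    · rw [Finset.card_image_of_injective _ fun i j hij => congrArg Prod.fst (hφ hij)]
      simp
  · simp only [Finset.mem_image, forall_exists_index, and_imp, forall_apply_eq_imp_iff₂]
    exact fun u hu w hw h => hsep u hu w hw fun e => h (e ▸ rfl)
  · rw [Finset.card_image_of_injOn hinj]
    have : Λ.card ≤ n * (B + 1) := (Nat.lt_mul_div_succ Λ.card (by omega)).le
    calc Λ.card ^ n ≤ (n * (B + 1)) ^ n := by gcongr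
      _ = n ^ n * (B + 1) ^ n := mul_pow _ _ _
      _ ≤ n ^ n * (4 ^ n * 𝒞.card ^ 2) := by gcongr
      _ = _ := by rw [mul_pow]; ring

/-! ### Signs making an exponential sum small -/

/-- Pointwise, `cosh (u + v) + cosh (u - v) = 2 cosh u cosh v` and `cosh v ≤ exp (v² / 2)`. -/
theorem integral_cosh_add_le {X : Type*} [TopologicalSpace X] [CompactSpace X]
    [MeasurableSpace X] [BorelSpace X] (μ : Measure X) [IsFiniteMeasure μ] (u v : C(X, ℝ))
    {b : ℝ} (hv : ∀ x, |v x| ≤ b) :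
    ∫ x, Real.cosh (u x + v x) ∂μ + ∫ x, Real.cosh (u x - v x) ∂μ ≤
      2 * (Real.exp (b ^ 2 / 2) * ∫ x, Real.cosh (u x) ∂μ) := by
  have hint : ∀ w : C(X, ℝ), Integrable (fun x => Real.cosh (w x)) μ := fun w =>
    (by fun_prop : Continuous fun x => Real.cosh (w x)).integrable_of_hasCompactSupport
      (HasCompactSupport.of_compactSpace _)
  have hadd : Integrable (fun x => Real.cosh (u x + v x)) μ := hint (u + v)
  have hsub : Integrable (fun x => Real.cosh (u x - v x)) μ := hint (u - v)
  rw [← integral_add hadd hsub, ← integral_const_mul, ← integral_const_mul]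
  refine integral_mono (hadd.add hsub)
    (((hint u).const_mul _).const_mul _) fun x => ?_
  have h1 : Real.cosh (v x) ≤ Real.exp (b ^ 2 / 2) := by
    refine (Real.cosh_le_exp_half_sq _).trans (Real.exp_le_exp.2 ?_)
    have := sq_le_sq' (abs_le.1 (hv x)).1 (abs_le.1 (hv x)).2
    linarith
  have h2 := mul_le_mul_of_nonneg_right h1 (Real.cosh_pos (u x)).le
  simp only [Real.cosh_add, Real.cosh_sub]
  linarith

/-- Signs are chosen one at a time: averaged over `±1`, a new term multiplies the potential by at
most `exp (t² / 2)`, so one of the two choices does no worse. Summing the real and imaginary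
potentials lets a single sign serve both. -/
theorem exists_sign_integral_cosh_le {X ι : Type*} [TopologicalSpace X] [CompactSpace X]
    [MeasurableSpace X] [BorelSpace X] (μ : Measure X) [IsProbabilityMeasure μ] [DecidableEq ι]
    (e : ι → C(X, ℂ)) (he : ∀ i, ‖e i‖ ≤ 1) (t : ℝ) (S : Finset ι) :
    ∃ ε : ι → ℂ, (∀ i, ‖ε i‖ = 1) ∧
      ∫ x, Real.cosh (t * ((∑ i ∈ S, ε i • e i) x).re) ∂μ +
        ∫ x, Real.cosh (t * ((∑ i ∈ S, ε i • e i) x).im) ∂μ ≤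
      2 * Real.exp (S.card * (t ^ 2 / 2)) := by
  induction S using Finset.induction_on with
  | empty => exact ⟨fun _ => 1, by simp, by simp; norm_num⟩
  | insert a S ha ih =>
    obtain ⟨ε, hε, h⟩ := ih
    set f := ∑ i ∈ S, ε i • e i with hf
    have hsum : ∀ s : ℂ, ∑ i ∈ insert a S, Function.update ε a s i • e i = f + s • e a := by
      intro s
      rw [Finset.sum_insert ha, Function.update_self, add_comm, hf]
      congr 1
      exact Finset.sum_congr rfl fun i hi => by
        rw [Function.update_of_ne (ne_of_mem_of_not_mem hi ha)]
    have hnorm : ∀ s : ℂ, ‖s‖ = 1 → ∀ i, ‖Function.update ε a s i‖ = 1 := by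
      intro s hs i
      rcases eq_or_ne i a with rfl | hi
      · rwa [Function.update_self]
      · rw [Function.update_of_ne hi, hε]
    have hb : ∀ x, ‖e a x‖ ≤ 1 := fun x => ((e a).norm_coe_le_norm x).trans (he a)
    have key : ∀ (L : C(ℂ, ℝ)), (∀ z, |L z| ≤ ‖z‖) →
        ∫ x, Real.cosh (t * L (f x) + t * L (e a x)) ∂μ +
          ∫ x, Real.cosh (t * L (f x) - t * L (e a x)) ∂μ ≤
        2 * (Real.exp (t ^ 2 / 2) * ∫ x, Real.cosh (t * L (f x)) ∂μ) := by
      intro L hL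
      have := integral_cosh_add_le μ (t • L.comp f) (t • L.comp (e a)) (b := |t|) fun x => by
        simp only [ContinuousMap.smul_apply, ContinuousMap.comp_apply, smul_eq_mul, abs_mul]
        exact mul_le_of_le_one_right (abs_nonneg _) ((hL _).trans (hb x))
      rw [sq_abs] at this
      exact this
    have hre := key ⟨Complex.re, Complex.continuous_re⟩ Complex.abs_re_le_norm
    have him := key ⟨Complex.im, Complex.continuous_im⟩ Complex.abs_im_le_norm
    simp only [ContinuousMap.coe_mk] at hre him
    have hexp : Real.exp ((insert a S).card * (t ^ 2 / 2)) =
        Real.exp (t ^ 2 / 2) * Real.exp (S.card * (t ^ 2 / 2)) := by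
      rw [Finset.card_insert_of_notMem ha, ← Real.exp_add]
      push_cast
      ring_nf
    have hmul := mul_le_mul_of_nonneg_left h (Real.exp_pos (t ^ 2 / 2)).le
    rw [hexp]
    by_contra! hcon
    have h1 := hcon _ (hnorm 1 (by simp))
    have h2 := hcon _ (hnorm (-1) (by simp))
    simp only [hsum, ContinuousMap.add_apply, ContinuousMap.smul_apply, Complex.add_re,
      Complex.add_im, smul_eq_mul, one_mul, neg_mul, Complex.neg_re, Complex.neg_im, mul_add,
      mul_neg] at h1 h2
    simp only [← sub_eq_add_neg] at h2
    linarith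

theorem pow_le_factorial_mul_cosh (a : ℝ) (q : ℕ) :
    a ^ (2 * q) ≤ (2 * q).factorial * Real.cosh a := by
  have h := le_hasSum (Real.hasSum_cosh a) q fun j _ =>
    div_nonneg ((even_two_mul j).pow_nonneg a) (Nat.cast_nonneg _)
  rw [div_le_iff₀ (by positivity)] at h
  linarith

theorem norm_pow_le_cosh (z : ℂ) (q : ℕ) :
    ‖z‖ ^ (2 * q) ≤ 2 ^ q * (2 * q).factorial * (Real.cosh z.re + Real.cosh z.im) := by
  have h0 : ‖z‖ ^ 2 ≤ 2 * max (z.re ^ 2) (z.im ^ 2) := by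
    rw [← Complex.normSq_eq_norm_sq, Complex.normSq_apply]
    have := le_max_left (z.re ^ 2) (z.im ^ 2)
    have := le_max_right (z.re ^ 2) (z.im ^ 2)
    linarith
  have h1 : max (z.re ^ 2) (z.im ^ 2) ^ q ≤
      (2 * q).factorial * (Real.cosh z.re + Real.cosh z.im) := by
    have hr := pow_le_factorial_mul_cosh z.re q
    have hi := pow_le_factorial_mul_cosh z.im q
    have := Real.cosh_pos z.re
    have := Real.cosh_pos z.im
    have : (0 : ℝ) < (2 * q).factorial := by positivity
    rcases max_choice (z.re ^ 2) (z.im ^ 2) with h | h <;> rw [h, ← pow_mul] <;> nlinarith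
  calc ‖z‖ ^ (2 * q) = (‖z‖ ^ 2) ^ q := pow_mul _ _ _
    _ ≤ (2 * max (z.re ^ 2) (z.im ^ 2)) ^ q := by gcongr
    _ = 2 ^ q * max (z.re ^ 2) (z.im ^ 2) ^ q := mul_pow _ _ _
    _ ≤ 2 ^ q * ((2 * q).factorial * (Real.cosh z.re + Real.cosh z.im)) := by gcongr
    _ = _ := by ring

/-- Signs for which an exponential sum with `n` frequencies has moments of subgaussian size. -/
theorem exists_sign_norm_toTorusL2_pow_le {d n q : ℕ} (hn : 1 ≤ n) (hq : 1 ≤ q)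
    (S : Finset (Fin d → ℤ)) (hS : S.card = n) :
    ∃ ε : (Fin d → ℤ) → ℂ, (∀ k, ‖ε k‖ = 1) ∧
      ‖toTorusL2 ((∑ k ∈ S, ε k • UnitAddTorus.mFourier k) ^ q)‖ ^ 2 ≤
        2 * (4 * Real.exp 1 * q * n) ^ q := by
  classical
  have hn' : (0 : ℝ) < n := by exact_mod_cast hn
  have hq' : (0 : ℝ) < q := by exact_mod_cast hq
  -- This scale makes the exponent `n * t ^ 2 / 2` equal to `q`.
  set t : ℝ := Real.sqrt (2 * q / n) with ht
  have ht2 : t ^ 2 = 2 * q / n := Real.sq_sqrt (by positivity)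
  obtain ⟨ε, hε, h⟩ := exists_sign_integral_cosh_le (torusMeasure d)
    (UnitAddTorus.mFourier (d := Fin d)) (fun _ => UnitAddTorus.mFourier_norm.le) t S
  refine ⟨ε, hε, ?_⟩
  set f := ∑ k ∈ S, ε k • UnitAddTorus.mFourier k
  have hexp : (S.card : ℝ) * (t ^ 2 / 2) = q := by
    rw [hS, ht2]; field_simp
  rw [hexp] at h
  have hint : ∀ w : C(UnitAddTorus (Fin d), ℝ), Integrable (fun x => w x) (torusMeasure d) :=
    fun w => w.continuous.integrable_of_hasCompactSupport (HasCompactSupport.of_compactSpace _)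
  have hire : Integrable (fun x => Real.cosh (t * (f x).re)) (torusMeasure d) :=
    hint ⟨fun x => Real.cosh (t * (f x).re), by fun_prop⟩
  have hiim : Integrable (fun x => Real.cosh (t * (f x).im)) (torusMeasure d) :=
    hint ⟨fun x => Real.cosh (t * (f x).im), by fun_prop⟩
  have h1 : t ^ (2 * q) * ‖toTorusL2 (f ^ q)‖ ^ 2 ≤
      2 ^ q * (2 * q).factorial * (2 * Real.exp q) := by
    rw [norm_toTorusL2_sq, ← integral_const_mul]
    refine le_trans ?_ (mul_le_mul_of_nonneg_left h (by positivity))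
    rw [← integral_add hire hiim, ← integral_const_mul]
    refine integral_mono (hint ⟨fun x => t ^ (2 * q) * ‖(f ^ q) x‖ ^ 2, by fun_prop⟩)
      ((hire.add hiim).const_mul _) fun x => ?_
    have := norm_pow_le_cosh (t * f x) q
    rw [norm_mul, Complex.norm_real, Real.norm_of_nonneg (Real.sqrt_nonneg _), mul_pow,
      Complex.re_ofReal_mul, Complex.im_ofReal_mul] at this
    simpa only [ContinuousMap.coe_mk, ContinuousMap.pow_apply, norm_pow, ← pow_mul, mul_comm q 2]
      using this
  have h2 : ((2 * q).factorial : ℝ) ≤ ((2 * q : ℝ) ^ 2) ^ q := by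
    rw [← pow_mul]
    exact_mod_cast Nat.factorial_le_pow (2 * q)
  rw [pow_mul, ht2] at h1
  have h3 : Real.exp q = Real.exp 1 ^ q := by rw [← Real.exp_nat_mul, mul_one]
  have h4 : (2 * q / n : ℝ) ^ q * ‖toTorusL2 (f ^ q)‖ ^ 2 ≤
      (2 * q / n : ℝ) ^ q * (2 * (4 * Real.exp 1 * q * n) ^ q) :=
    calc _ ≤ 2 ^ q * (2 * q).factorial * (2 * Real.exp q) := h1
      _ ≤ 2 ^ q * ((2 * q : ℝ) ^ 2) ^ q * (2 * Real.exp q) := by gcongr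
      _ = 2 * (2 * (2 * q : ℝ) ^ 2 * Real.exp 1) ^ q := by rw [h3, mul_pow (2 * (2 * q : ℝ) ^ 2), mul_pow 2 ((2 * q : ℝ) ^ 2)]; ring
      _ = 2 * ((2 * q / n : ℝ) * (4 * Real.exp 1 * q * n)) ^ q := by
        congr 2; field_simp; ring
      _ = _ := by rw [mul_pow (2 * q / n : ℝ)]; ring
  exact le_of_mul_le_mul_left h4 (by positivity)

/-- Signs for which an exponential sum with `n` frequencies in a cube is uniformly small. -/
theorem exists_sign_norm_le {d M n q : ℕ} (hn : 1 ≤ n) (hq : 1 ≤ q) (hdq : d ≤ q)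
    (hN : ((2 * M + 1) ^ d : ℝ) ≤ Real.exp q)
    (S : Finset (Fin d → ℤ)) (hS : S.card = n) (hSM : S ⊆ freqCubeFinset d M) :
    ∃ ε : (Fin d → ℤ) → ℂ, (∀ k, ‖ε k‖ = 1) ∧
      ‖∑ k ∈ S, ε k • UnitAddTorus.mFourier k‖ ≤ 8 * q * Real.sqrt n := by
  obtain ⟨ε, hε, h⟩ := exists_sign_norm_toTorusL2_pow_le hn hq S hS
  refine ⟨ε, hε, ?_⟩
  set f := ∑ k ∈ S, ε k • UnitAddTorus.mFourier k
  have hn' : (1 : ℝ) ≤ n := by exact_mod_cast hn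
  have hq' : (1 : ℝ) ≤ q := by exact_mod_cast hq
  have hf : f ∈ trigPoly d M :=
    Submodule.sum_mem _ fun k hk => Submodule.smul_mem _ _ (mFourier_mem_trigPoly (hSM hk))
  have hfq := pow_mem_trigPoly hf q
  rw [trigPoly, ← coe_freqCubeFinset] at hfq
  have hnik := norm_sq_le_card_mul_norm_toTorusL2_sq _ _ hfq
  rw [card_freqCubeFinset] at hnik
  push_cast at hnik
  have h3 : Real.exp q = Real.exp 1 ^ q := by rw [← Real.exp_nat_mul, mul_one]
  -- The Nikolskii factor for `f ^ q` is at most a `q`-th power, so after taking roots it costs only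
  -- `q * e`; both `d ≤ q` and `N ≤ e ^ q` are needed.
  have hcard : (2 * (q * M) + 1 : ℝ) ^ d ≤ (q * Real.exp 1) ^ q :=
    calc (2 * (q * M) + 1 : ℝ) ^ d ≤ (q * (2 * M + 1)) ^ d := by
          gcongr; nlinarith [(Nat.cast_nonneg M : (0 : ℝ) ≤ M)]
      _ = q ^ d * (2 * M + 1) ^ d := mul_pow _ _ _
      _ ≤ q ^ q * Real.exp q := by gcongr
      _ = _ := by rw [h3, mul_pow]
  -- This gives `2 * 4 * e ^ 2 ≤ 64`, the source of the constant `8`.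
  have he : Real.exp 1 ^ 2 ≤ 8 := by
    have := Real.exp_one_lt_d9
    have := Real.exp_pos 1
    nlinarith
  have hbound : ‖f ^ q‖ ^ 2 ≤ ((8 * q * Real.sqrt n) ^ 2) ^ q :=
    calc ‖f ^ q‖ ^ 2 ≤ (q * Real.exp 1) ^ q * (2 * (4 * Real.exp 1 * q * n) ^ q) := by
          refine hnik.trans ?_
          gcongr
      _ = 2 * (4 * Real.exp 1 ^ 2 * q ^ 2 * n) ^ q := by
          rw [mul_left_comm, ← mul_pow]; ring_nf
      _ ≤ 2 ^ q * (4 * Real.exp 1 ^ 2 * q ^ 2 * n) ^ q := by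
          gcongr; exact le_self_pow₀ one_le_two (by omega)
      _ = (2 * (4 * Real.exp 1 ^ 2 * q ^ 2 * n)) ^ q := (mul_pow _ _ _).symm
      _ ≤ _ := by
          gcongr
          rw [mul_pow, mul_pow, Real.sq_sqrt (by positivity)]
          have : (0 : ℝ) ≤ q ^ 2 * n := by positivity
          nlinarith
  refine (ContinuousMap.norm_le _ (by positivity)).2 fun x => ?_
  have hx : (‖f x‖ ^ 2) ^ q ≤ ((8 * q * Real.sqrt n) ^ 2) ^ q :=
    calc (‖f x‖ ^ 2) ^ q = ‖(f ^ q) x‖ ^ 2 := by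
          rw [ContinuousMap.pow_apply, norm_pow, ← pow_mul, ← pow_mul, mul_comm]
      _ ≤ ‖f ^ q‖ ^ 2 := by gcongr; exact (f ^ q).norm_coe_le_norm x
      _ ≤ _ := hbound
  exact (pow_le_pow_iff_left₀ (norm_nonneg _) (by positivity) two_ne_zero).1
    ((pow_le_pow_iff_left₀ (by positivity) (by positivity) (by omega)).1 hx)

/-! ### From recovery to separation modulo the samples -/

theorem bestTermError_le {d s : ℕ} (f : C(UnitAddTorus (Fin d), ℂ)) (S : Finset (Fin d → ℤ))
    (c : (Fin d → ℤ) → ℂ) (hS : S.card ≤ s) :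
    bestTermError s f ≤ ‖f - ∑ k ∈ S, c k • UnitAddTorus.mFourier k‖ :=
  csInf_le ⟨0, by rintro _ ⟨S, c, -, rfl⟩; exact norm_nonneg _⟩ ⟨S, c, hS, rfl⟩

theorem cubeError_nonpos {d M : ℕ} (Y : Seminorm ℂ C(UnitAddTorus (Fin d), ℂ))
    {f : C(UnitAddTorus (Fin d), ℂ)} (hf : f ∈ trigPoly d M) : cubeError M Y f ≤ 0 :=
  csInf_le ⟨0, by rintro _ ⟨g, -, rfl⟩; exact apply_nonneg _ _⟩ ⟨f, hf, by simp⟩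

/-- If sampling recovery is possible, a sparse polynomial is dominated by every polynomial with the
same samples. -/
theorem SatisfiesErrorBound.norm_le_of_samples_eq {d n M m : ℕ} {C : ℝ} (hC : 0 < C)
    {Y : Seminorm ℂ C(UnitAddTorus (Fin d), ℂ)} {X : Fin m → UnitAddTorus (Fin d)}
    {T : (Fin m → ℂ) → TorusL2 d} (h : SatisfiesErrorBound C n M Y (recoveryMap X T))
    {v z : C(UnitAddTorus (Fin d), ℂ)} (hv : v ∈ trigPoly d M) (hz : z ∈ trigPoly d M)
    (S : Finset (Fin d → ℤ)) (hS : S.card ≤ 2 * n) (c : (Fin d → ℤ) → ℂ)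
    (hvS : v = ∑ k ∈ S, c k • UnitAddTorus.mFourier k) (hvz : ∀ l, v (X l) = z (X l)) :
    ‖toTorusL2 v‖ ≤ (1 + C) * ‖z‖ := by
  have hR : recoveryMap X T v = recoveryMap X T z := congrArg T (funext hvz)
  have h1 : ‖toTorusL2 v - recoveryMap X T v‖ ≤ 0 := by
    have hb := bestTermError_le v S c hS
    rw [← hvS, sub_self, norm_zero] at hb
    exact (h v).trans (mul_nonpos_of_nonneg_of_nonpos hC.le
      (add_nonpos hb (cubeError_nonpos Y hv)))
  have h2 : ‖toTorusL2 z - recoveryMap X T z‖ ≤ C * ‖z‖ := by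
    -- No sparsity of `z` is available, so it is approximated by zero.
    have hb := bestTermError_le (s := 2 * n) z ∅ 0 (by simp)
    rw [Finset.sum_empty, sub_zero] at hb
    refine (h z).trans (mul_le_mul_of_nonneg_left ?_ hC.le)
    linarith [cubeError_nonpos Y hz]
  rw [sub_eq_zero.1 (norm_le_zero_iff.1 h1), hR]
  have h3 := norm_sub_norm_le (recoveryMap X T z) (toTorusL2 z)
  rw [norm_sub_rev] at h3
  have h4 := norm_toTorusL2_le z
  linarith

/-- Bessel's inequality on `S \ S'`, where the coefficients are the unimodular `ε k`. -/
theorem sqrt_card_sdiff_le_norm_toTorusL2_sub {d : ℕ} (S S' : Finset (Fin d → ℤ))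
    (ε ε' : (Fin d → ℤ) → ℂ) (hε : ∀ k, ‖ε k‖ = 1) :
    Real.sqrt (S \ S').card ≤ ‖toTorusL2 (∑ k ∈ S, ε k • UnitAddTorus.mFourier k -
      ∑ k ∈ S', ε' k • UnitAddTorus.mFourier k)‖ := by
  classical
  refine Real.sqrt_le_iff.2 ⟨norm_nonneg _, ?_⟩
  have ho := orthonormal_toTorusL2_mFourier d
  refine le_trans (le_of_eq ?_) (ho.sum_inner_products_le (s := S \ S') _)
  rw [Finset.card_eq_sum_ones, Nat.cast_sum]
  refine Finset.sum_congr rfl fun k hk => ?_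
  obtain ⟨hk, hk'⟩ := Finset.mem_sdiff.1 hk
  have h0 : inner ℂ (toTorusL2 (UnitAddTorus.mFourier k))
      (∑ l ∈ S', ε' l • toTorusL2 (UnitAddTorus.mFourier l)) = 0 := by
    rw [inner_sum]
    refine Finset.sum_eq_zero fun l hl => ?_
    rw [inner_smul_right, ho.inner_eq_zero (ne_of_mem_of_not_mem hl hk').symm, mul_zero]
  rw [toTorusL2_sub, toTorusL2_sum_smul, toTorusL2_sum_smul, inner_sub_right, h0,
    ho.inner_right_sum ε hk, sub_zero, hε]
  norm_num

/-- Volumetric bound for vectors that stay separated modulo the kernel of a map of rank at most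
`m`. -/
theorem card_le_of_separated_mod_ker {V ι : Type*} [NormedAddCommGroup V] [NormedSpace ℂ V]
    [FiniteDimensional ℂ V] {m : ℕ} (L : V →ₗ[ℂ] (Fin m → ℂ)) (s : Finset ι) (F : ι → V)
    {R δ : ℝ} (hR : 0 ≤ R) (hδ : 0 < δ) (hF : ∀ i ∈ s, ‖F i‖ ≤ R)
    (hsep : ∀ i ∈ s, ∀ j ∈ s, i ≠ j → ∀ z, L z = L (F i - F j) → δ ≤ ‖z‖) :
    (s.card : ℝ) ≤ (1 + 2 * R / δ) ^ (2 * m) := by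
  classical
  -- Closedness of the kernel makes the quotient seminorm a norm.
  have hclosed : IsClosed (LinearMap.ker L : Set V) := Submodule.closed_of_finiteDimensional _
  let Q := V ⧸ LinearMap.ker L
  have hrank : Module.finrank ℝ Q ≤ 2 * m := by
    rw [finrank_real_of_complex, L.quotKerEquivRange.finrank_eq]
    refine Nat.mul_le_mul_left 2 ((Submodule.finrank_le _).trans ?_)
    rw [Module.finrank_fin_fun]
  have : FiniteDimensional ℝ Q := FiniteDimensional.complexToReal Q
  have hsepQ : ∀ i ∈ s, ∀ j ∈ s, i ≠ j →
      δ ≤ ‖(Submodule.Quotient.mk (F i) : Q) - Submodule.Quotient.mk (F j)‖ := by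
    intro i hi j hj hne
    rw [← Submodule.Quotient.mk_sub]
    refine le_of_forall_pos_le_add fun η hη => ?_
    obtain ⟨z, hz, hzη⟩ := Submodule.Quotient.norm_mk_lt
      (Submodule.Quotient.mk (F i - F j) : Q) hη
    refine (hsep i hi j hj hne z ?_).trans hzη.le
    have hker := LinearMap.mem_ker.1 ((Submodule.Quotient.eq _).1 hz)
    rwa [map_sub, sub_eq_zero] at hker
  have hinj : Set.InjOn (fun i => (Submodule.Quotient.mk (F i) : Q)) s := by
    intro i hi j hj heq
    by_contra hne
    have := hsepQ i hi j hj hne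
    rw [sub_eq_zero.2 heq, norm_zero] at this
    linarith
  have hvol := card_le_of_separated_of_norm_le
    (s.image fun i => (Submodule.Quotient.mk (F i) : Q)) hR hδ
    (by
      simp only [Finset.mem_image, forall_exists_index, and_imp, forall_apply_eq_imp_iff₂]
      exact fun i hi => (Submodule.Quotient.norm_mk_le _ _).trans (hF i hi))
    (by
      simp only [Finset.mem_image, forall_exists_index, and_imp, forall_apply_eq_imp_iff₂]
      exact fun i hi j hj hne => hsepQ i hi j hj fun e => hne (e ▸ rfl))
  rw [Finset.card_image_of_injOn hinj] at hvol
  exact hvol.trans (pow_le_pow_right₀ (le_add_of_nonneg_right (by positivity)) hrank)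

theorem sum_smul_sub_sum_smul {R V ι : Type*} [Ring R] [AddCommGroup V] [Module R V]
    [DecidableEq ι] (S S' : Finset ι) (a b : ι → R) (e : ι → V) :
    ∑ k ∈ S, a k • e k - ∑ k ∈ S', b k • e k =
      ∑ k ∈ S ∪ S', ((if k ∈ S then a k else 0) - (if k ∈ S' then b k else 0)) • e k := by
  simp only [sub_smul, Finset.sum_sub_distrib, ite_smul, zero_smul, Finset.sum_ite_mem]
  rw [Finset.inter_eq_right.2 Finset.subset_union_left,
    Finset.inter_eq_right.2 Finset.subset_union_right]

/-- Volume comparison with radius `8q√n` and separation `√n/(2(1 + C))`; the factor `√n` cancels in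
their ratio. -/
theorem card_le_of_satisfiesErrorBound {d n M m q : ℕ} {C : ℝ} (hC : 0 < C)
    {Y : Seminorm ℂ C(UnitAddTorus (Fin d), ℂ)} {X : Fin m → UnitAddTorus (Fin d)}
    {T : (Fin m → ℂ) → TorusL2 d} (h : SatisfiesErrorBound C n M Y (recoveryMap X T))
    (hn : 1 ≤ n) (hq : 1 ≤ q) (hdq : d ≤ q) (hN : ((2 * M + 1) ^ d : ℝ) ≤ Real.exp q)
    (𝒮 : Finset (Finset (Fin d → ℤ)))
    (h𝒮 : ∀ S ∈ 𝒮, S ⊆ freqCubeFinset d M ∧ S.card = n)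
    (hsep : ∀ S ∈ 𝒮, ∀ S' ∈ 𝒮, S ≠ S' → n ≤ 4 * (S \ S').card) :
    (𝒮.card : ℝ) ≤ (1 + 32 * (1 + C) * q) ^ (2 * m) := by
  classical
  have hn' : (0 : ℝ) < n := by exact_mod_cast hn
  have hex : ∀ S : Finset (Fin d → ℤ), ∃ ε : (Fin d → ℤ) → ℂ, (∀ k, ‖ε k‖ = 1) ∧
      (S ∈ 𝒮 → ‖∑ k ∈ S, ε k • UnitAddTorus.mFourier k‖ ≤ 8 * q * Real.sqrt n) := by
    intro S
    by_cases hS : S ∈ 𝒮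
    · obtain ⟨ε, hε, hle⟩ := exists_sign_norm_le hn hq hdq hN S (h𝒮 S hS).2 (h𝒮 S hS).1
      exact ⟨ε, hε, fun _ => hle⟩
    · exact ⟨fun _ => 1, by simp, fun h => absurd h hS⟩
  choose ε hε hle using hex
  let F : Finset (Fin d → ℤ) → trigPoly d M := fun S =>
    ∑ k : S, if hk : (k : Fin d → ℤ) ∈ freqCubeFinset d M then
      ε S k • ⟨UnitAddTorus.mFourier (k : Fin d → ℤ), mFourier_mem_trigPoly hk⟩ else 0
  have hF : ∀ S ∈ 𝒮, (F S : C(UnitAddTorus (Fin d), ℂ)) =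
      ∑ k ∈ S, ε S k • UnitAddTorus.mFourier k := by
    intro S hS
    rw [← Finset.sum_coe_sort S, Submodule.coe_sum]
    refine Finset.sum_congr rfl fun k _ => ?_
    rw [dif_pos ((h𝒮 S hS).1 k.2)]
    rfl
  let L : trigPoly d M →ₗ[ℂ] (Fin m → ℂ) :=
    { toFun := fun f l => (f : C(UnitAddTorus (Fin d), ℂ)) (X l)
      map_add' := fun _ _ => rfl
      map_smul' := fun _ _ => rfl }
  have hsepL : ∀ S ∈ 𝒮, ∀ S' ∈ 𝒮, S ≠ S' → ∀ z, L z = L (F S - F S') →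
      Real.sqrt n / 2 / (1 + C) ≤ ‖z‖ := by
    intro S hS S' hS' hne z hz
    have hsum : ((F S - F S' : trigPoly d M) : C(UnitAddTorus (Fin d), ℂ)) =
        ∑ k ∈ S ∪ S', ((if k ∈ S then ε S k else 0) - (if k ∈ S' then ε S' k else 0)) •
          UnitAddTorus.mFourier k := by
      rw [Submodule.coe_sub, hF S hS, hF S' hS']
      exact sum_smul_sub_sum_smul S S' (ε S) (ε S') _
    have hcard : (S ∪ S').card ≤ 2 * n := by
      refine (Finset.card_union_le _ _).trans ?_
      rw [(h𝒮 S hS).2, (h𝒮 S' hS').2]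
      omega
    have hup := h.norm_le_of_samples_eq hC (F S - F S').2 z.2 (S ∪ S') hcard _ hsum fun l =>
      (congrFun hz l).symm
    have hlow := sqrt_card_sdiff_le_norm_toTorusL2_sub S S' (ε S) (ε S') (hε S)
    rw [← hF S hS, ← hF S' hS', ← Submodule.coe_sub] at hlow
    have hdiff : Real.sqrt n / 2 ≤ Real.sqrt (S \ S').card := by
      refine Real.le_sqrt_of_sq_le ?_
      rw [div_pow, Real.sq_sqrt hn'.le]
      have : (n : ℝ) ≤ 4 * (S \ S').card := by exact_mod_cast hsep S hS S' hS' hne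
      linarith
    rw [div_le_iff₀ (by positivity), mul_comm]
    exact hdiff.trans (hlow.trans hup)
  have hsqrt := Real.sqrt_pos.2 hn'
  have hvol := card_le_of_separated_mod_ker L 𝒮 F (R := 8 * q * Real.sqrt n) (by positivity)
    (by positivity) (fun S hS => by
      rw [Submodule.coe_norm, hF S hS]
      exact hle S hS) hsepL
  have hratio : 2 * (8 * q * Real.sqrt n) / (Real.sqrt n / 2 / (1 + C)) = 32 * (1 + C) * q := by
    field_simp
    ring
  rwa [hratio] at hvol

/-! ### Logarithms and asymptotics -/

theorem natCast_le_log_cube {d M : ℕ} (hM : 1 ≤ M) :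
    (d : ℝ) ≤ Real.log ((2 * M + 1) ^ d : ℝ) := by
  rw [Real.log_pow]
  refine le_mul_of_one_le_right (Nat.cast_nonneg d) ?_
  rw [Real.le_log_iff_exp_le (by positivity)]
  have : (1 : ℝ) ≤ M := by exact_mod_cast hM
  linarith [Real.exp_one_lt_d9]

theorem sample_lower_bound {C : ℝ} (hC : 0 < C) {d M n m : ℕ} (hd : 1 ≤ d) (hM : 1 ≤ M)
    (hn : 1 ≤ n) (Y : Seminorm ℂ C(UnitAddTorus (Fin d), ℂ))
    (X : Fin m → UnitAddTorus (Fin d)) (T : (Fin m → ℂ) → TorusL2 d)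
    (h : SatisfiesErrorBound C n M Y (recoveryMap X T)) :
    (n : ℝ) * (Real.log (((2 * M + 1) ^ d : ℝ) / (4 * n)) /
      (4 * Real.log (65 * (1 + C) * d * Real.log ((2 * M + 1) ^ d : ℝ)))) ≤ (m : ℝ) := by
  classical
  have hn' : (1 : ℝ) ≤ n := by exact_mod_cast hn
  have hd' : (1 : ℝ) ≤ d := by exact_mod_cast hd
  set N : ℝ := (2 * M + 1) ^ d with hNdef
  have hNpos : 0 < N := by positivity
  have hdN : (d : ℝ) ≤ Real.log N := natCast_le_log_cube hM
  have hlogN : 1 ≤ Real.log N := hd'.trans hdN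
  -- With `q ≤ 2 log N`, `32(1 + C)q` becomes `64(1 + C) log N`; the summand `1` raises `64` to
  -- `65`, and the factor `d` is slack.
  have hbase : 1 + 64 * (1 + C) * Real.log N ≤ 65 * (1 + C) * d * Real.log N := by
    have h1 : 1 ≤ (1 + C) * Real.log N := by nlinarith
    have h2 : 65 * ((1 + C) * Real.log N) * 1 ≤ 65 * ((1 + C) * Real.log N) * d := by
      gcongr
    linarith
  have hbase1 : 1 < 65 * (1 + C) * d * Real.log N := by
    refine lt_of_lt_of_le ?_ hbase
    have : 0 < (1 + C) * Real.log N := by positivity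
    linarith
  have hlogpos := Real.log_pos hbase1
  -- For `N < 4n` the left side is nonpositive; otherwise the cube is large enough for the family of
  -- sets.
  rcases lt_or_ge N (4 * n) with hlt | hge
  · refine le_trans (mul_nonpos_of_nonneg_of_nonpos (by positivity)
      (div_nonpos_of_nonpos_of_nonneg (Real.log_nonpos (by positivity) ?_) (by positivity)))
      (Nat.cast_nonneg m)
    exact (div_le_one (by positivity)).2 hlt.le
  have hcube : ((freqCubeFinset d M).card : ℝ) = N := by
    rw [card_freqCubeFinset]; push_cast; rfl
  obtain ⟨𝒮, h𝒮, hsep, hcard⟩ := exists_family_large_sdiff (freqCubeFinset d M) hn (by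
    have : (4 * n : ℝ) ≤ (freqCubeFinset d M).card := hcube ▸ hge
    exact_mod_cast this)
  have hceil : Real.log N ≤ ⌈Real.log N⌉₊ := Nat.le_ceil _
  have hupper := card_le_of_satisfiesErrorBound hC h hn (q := ⌈Real.log N⌉₊)
    (Nat.one_le_ceil_iff.2 (by linarith)) (by exact_mod_cast hdN.trans hceil)
    ((Real.log_le_iff_le_exp hNpos).1 hceil) 𝒮 h𝒮 hsep
  have hq2 : (⌈Real.log N⌉₊ : ℝ) ≤ 2 * Real.log N := by
    have := Nat.ceil_lt_add_one (zero_le_one.trans hlogN)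
    linarith
  have hupper2 : (𝒮.card : ℝ) ≤ (65 * (1 + C) * d * Real.log N) ^ (2 * m) := by
    refine hupper.trans (pow_le_pow_left₀ (by positivity) (le_trans ?_ hbase) _)
    have : 32 * (1 + C) * ⌈Real.log N⌉₊ ≤ 32 * (1 + C) * (2 * Real.log N) := by gcongr
    linarith
  have hcardR : (N / (4 * n)) ^ n ≤ (𝒮.card : ℝ) ^ 2 := by
    rw [div_pow, div_le_iff₀ (by positivity), ← hcube, mul_comm]
    exact_mod_cast hcard
  have hfinal : (N / (4 * n)) ^ n ≤ (65 * (1 + C) * d * Real.log N) ^ (4 * m) := by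
    refine hcardR.trans ?_
    rw [show 4 * m = 2 * m * 2 by ring, pow_mul _ (2 * m) 2]
    gcongr
  have hlog := Real.log_le_log (by positivity) hfinal
  rw [Real.log_pow, Real.log_pow] at hlog
  rw [← mul_div_assoc, div_le_iff₀ (by positivity)]
  push_cast at hlog
  linarith

/-- The lower bound exceeds any constant as the cube grows. -/
theorem eventually_lt_log_div_log {A K a : ℝ} (hA : 1 ≤ A) (hK : 0 < K) (ha : 0 < a) :
    ∀ᶠ N : ℕ in Filter.atTop, ∀ D : ℝ, 1 ≤ D → D ≤ Real.log N →
      K < Real.log (N / a) / (4 * Real.log (A * D * Real.log N)) := by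
  have hlim : Filter.Tendsto (fun N : ℕ => Real.log N) Filter.atTop Filter.atTop :=
    Real.tendsto_log_atTop.comp tendsto_natCast_atTop_atTop
  have ho : ∀ᶠ L : ℝ in Filter.atTop,
      Real.log a + 4 * K * (Real.log A + 2 * Real.log L) < L := by
    have h1 := (Real.isLittleO_log_id_atTop.const_mul_left (8 * K)).add
      (Asymptotics.isLittleO_const_id_atTop (Real.log a + 4 * K * Real.log A))
    have h2 := h1.bound (c := 1 / 2) (by norm_num)
    filter_upwards [h2, Filter.eventually_gt_atTop 0] with L hL hpos
    simp only [id, Real.norm_eq_abs, abs_of_pos hpos] at hL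
    linarith [le_abs_self (8 * K * Real.log L + (Real.log a + 4 * K * Real.log A))]
  filter_upwards [hlim.eventually ho, hlim.eventually_gt_atTop 1, Filter.eventually_gt_atTop 0]
    with N hN hL hN0 D hD1 hD
  have hN0' : (0 : ℝ) < N := by exact_mod_cast hN0
  have hbase : 1 < A * D * Real.log N := by
    have h1 : 1 ≤ A * D := one_le_mul_of_one_le_of_one_le hA hD1
    nlinarith
  -- Since `D ≤ log N`, the denominator is of order `log log N` uniformly in the dimension.
  have hlog : Real.log (A * D * Real.log N) ≤ Real.log A + 2 * Real.log (Real.log N) := by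
    have hle : A * D * Real.log N ≤ A * Real.log N ^ 2 := by
      rw [sq, ← mul_assoc]
      gcongr
    refine (Real.log_le_log (by linarith) hle).trans (le_of_eq ?_)
    rw [Real.log_mul (by positivity) (by positivity), Real.log_pow]
    norm_num
  have hpos := Real.log_pos hbase
  rw [lt_div_iff₀ (by positivity), Real.log_div hN0'.ne' ha.ne']
  nlinarith

theorem mainTheorem7 :
    -- the lower bound on the number of samples
    (∃ c : ℝ, 1 ≤ c ∧
      ∀ (C : ℝ), 0 < C →
      ∀ (d M n m : ℕ), 1 ≤ d → 1 ≤ M → 1 ≤ n →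
      ∀ (Y : Seminorm ℂ C(UnitAddTorus (Fin d), ℂ))
        (X : Fin m → UnitAddTorus (Fin d)) (T : (Fin m → ℂ) → TorusL2 d),
        SatisfiesErrorBound C n M Y (recoveryMap X T) →
        (n : ℝ) * (Real.log (((2 * M + 1) ^ d : ℝ) / (4 * n)) /
            (4 * Real.log (c * (1 + C) * d * Real.log ((2 * M + 1) ^ d : ℝ)))) ≤ (m : ℝ)) ∧
    -- a number of samples proportional to the sparsity does not suffice
    (∀ (C K : ℝ), 0 < C → 0 < K → ∀ n : ℕ, 1 ≤ n →
      ∃ N₀ : ℕ, ∀ (d M m : ℕ), 1 ≤ d → 1 ≤ M → N₀ ≤ (2 * M + 1) ^ d →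
      ∀ (Y : Seminorm ℂ C(UnitAddTorus (Fin d), ℂ))
        (X : Fin m → UnitAddTorus (Fin d)) (T : (Fin m → ℂ) → TorusL2 d),
        SatisfiesErrorBound C n M Y (recoveryMap X T) →
        K * n < (m : ℝ)) := by
  refine ⟨⟨65, by norm_num, fun C hC d M n m hd hM hn Y X T h =>
    sample_lower_bound hC hd hM hn Y X T h⟩, fun C K hC hK n hn => ?_⟩
  have hn' : (1 : ℝ) ≤ n := by exact_mod_cast hn
  obtain ⟨N₀, hN₀⟩ := Filter.eventually_atTop.1
    (eventually_lt_log_div_log (A := 65 * (1 + C)) (a := 4 * n) (by linarith) hK (by positivity))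
  refine ⟨N₀, fun d M m hd hM hN Y X T h => ?_⟩
  have hlow := sample_lower_bound hC hd hM hn Y X T h
  have hK' := hN₀ _ hN d (by exact_mod_cast hd) (by
    push_cast
    exact natCast_le_log_cube hM)
  push_cast at hK'
  refine lt_of_lt_of_le ?_ hlow
  rw [mul_comm]
  gcongr
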